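/- Let $K$ be a field, let $a_1,a_2,\dots\in K$ and let $q_1,q_2,\dots$ be positive integers. Put $\tilde q_0=1$, $\tilde q_n=q_n$ for $n\ge 1$, and $p_i=\sum_{j=0}^{i}(-1)^{i-j}\tilde q_j$, and assume that $p_i\ge 0$ for all $i\ge 0$. Let $(c_n)_{n\ge 0}$ be the sequence whose generating function $\sum_n c_nx^n\in K[[x]]$ is given by the C-fraction $$\cfrac{1}{1+\cfrac{a_1x^{q_1}}{1+\cfrac{a_2x^{q_2}}{1+\cfrac{a_3x^{q_3}}{1+\cdots}}}},$$ meaning that every coefficient of $\sum_n c_nx^n$ is the eventual value of the corresponding coefficient of the finite truncations of the fraction. For $n\ge 1$ let $h_n=\det(c_{i+j})_{0\le i,j\le n-1}$ be the Hankel determinant of order $n$. Then: 1. $h_n=0$ for every $n\ge 1$ that is not of the form $n=\sum_{k=0}^{m}p_k$ with $m\ge 0$. 2. If $n=\sum_{k=0}^{m}p_k$ for some $m\ge 0$, then $$h_n=\prod_{i=0}^{m}(-1)^{\frac{p_i(p_i+1)}{2}}\cdot(-1)^{1+\sum_{i=0}^{m-1}i\,p_{i+1}}\cdot\prod_{k=1}^{m}a_k^{\sum_{i=k}^{m}p_i},$$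 where $0^0=1$; in particular $h_n\ne 0$ if $a_1,\dots,a_m$ are all nonzero. -/

import Mathlib

open Filter
open scoped PowerSeries

noncomputable section

/-- The finite continued fraction
`1 + a k * X ^ q k / (1 + a (k+1) * X ^ q (k+1) / (1 + ⋯))` with exactly `n` partial quotients,
the last one being `a (k+n-1) * X ^ q (k+n-1) / 1`, as a formal power series. -/
def cFracTrunc {K : Type*} [Field K] (a : ℕ → K) (q : ℕ → ℕ) : ℕ → ℕ → K⟦X⟧
  | 0, _ => 1
  | n + 1, k => 1 + PowerSeries.C (a k) * PowerSeries.X ^ q k * (cFracTrunc a q n (k + 1))⁻¹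

/-- The `n`-th approximant of `1 / (1 + a₁ X ^ q₁ / (1 + a₂ X ^ q₂ / (1 + ⋯)))`, that is
`1 / (1 + a₁ X ^ q₁ / (⋯ / (1 + aₙ X ^ qₙ)))`. The values `a 0` and `q 0` play no role. -/
def cFracApprox {K : Type*} [Field K] (a : ℕ → K) (q : ℕ → ℕ) (n : ℕ) : K⟦X⟧ :=
  (cFracTrunc a q n 1)⁻¹

/-- The power series `g` is given by the C-fraction
`1 / (1 + a₁ X ^ q₁ / (1 + a₂ X ^ q₂ / (1 + ⋯)))`:
every coefficient of `g` is the eventual value of that coefficient of the approximants. -/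
def IsCFraction {K : Type*} [Field K] (a : ℕ → K) (q : ℕ → ℕ) (g : K⟦X⟧) : Prop :=
  ∀ N : ℕ, ∀ᶠ n in atTop,
    PowerSeries.coeff N (cFracApprox a q n) = PowerSeries.coeff N g

/-- The truncations are invertible power series when the exponents are positive. -/
theorem constantCoeff_cFracTrunc {K : Type*} [Field K] (a : ℕ → K) (q : ℕ → ℕ)
    (n k : ℕ) (hk : 1 ≤ k) (hq : ∀ i, 1 ≤ i → 1 ≤ q i) :
    PowerSeries.constantCoeff (cFracTrunc a q n k) = 1 := by
  cases n with
  | zero => simp [cFracTrunc]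
  | succ n =>
    have h : q k ≠ 0 := by have := hq k hk; omega
    simp [cFracTrunc, h]

theorem X_pow_dvd_cFracTrunc_sub {K : Type*} [Field K] (a : ℕ → K) (q : ℕ → ℕ)
    (n : ℕ) (hq : ∀ i, 1 ≤ i → 1 ≤ q i) :
    ∀ k, 1 ≤ k → (PowerSeries.X : K⟦X⟧) ^ (n + 1) ∣
      cFracTrunc a q (n + 1) k - cFracTrunc a q n k := by
  induction n with
  | zero =>
    intro k hk
    obtain ⟨r, hr⟩ := Nat.exists_eq_add_of_le (hq k hk)
    refine ⟨PowerSeries.C (a k) * PowerSeries.X ^ r, ?_⟩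
    simp only [cFracTrunc, hr, inv_one]
    ring
  | succ n ih =>
    intro k hk
    obtain ⟨r, hr⟩ := Nat.exists_eq_add_of_le (hq k hk)
    obtain ⟨w, hw⟩ := ih (k + 1) (by omega)
    have h1 : PowerSeries.constantCoeff (cFracTrunc a q (n + 1) (k + 1)) ≠ 0 := by
      rw [constantCoeff_cFracTrunc a q _ _ (by omega) hq]; exact one_ne_zero
    have h0 : PowerSeries.constantCoeff (cFracTrunc a q n (k + 1)) ≠ 0 := by
      rw [constantCoeff_cFracTrunc a q _ _ (by omega) hq]; exact one_ne_zero
    have e1 := PowerSeries.mul_inv_cancel _ h1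
    have e0 := PowerSeries.mul_inv_cancel _ h0
    have key : (cFracTrunc a q (n + 1) (k + 1))⁻¹ - (cFracTrunc a q n (k + 1))⁻¹ =
        -(PowerSeries.X ^ (n + 1) * w) *
          ((cFracTrunc a q (n + 1) (k + 1))⁻¹ * (cFracTrunc a q n (k + 1))⁻¹) := by
      rw [← hw]
      linear_combination (cFracTrunc a q n (k + 1))⁻¹ * e1
        - (cFracTrunc a q (n + 1) (k + 1))⁻¹ * e0
    have hs : cFracTrunc a q (n + 1 + 1) k - cFracTrunc a q (n + 1) k =
        PowerSeries.C (a k) * PowerSeries.X ^ q k *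
          ((cFracTrunc a q (n + 1) (k + 1))⁻¹ - (cFracTrunc a q n (k + 1))⁻¹) := by
      rw [show cFracTrunc a q (n + 1 + 1) k = 1 + PowerSeries.C (a k) * PowerSeries.X ^ q k *
        (cFracTrunc a q (n + 1) (k + 1))⁻¹ from rfl,
        show cFracTrunc a q (n + 1) k = 1 + PowerSeries.C (a k) * PowerSeries.X ^ q k *
        (cFracTrunc a q n (k + 1))⁻¹ from rfl]
      ring
    rw [hs, key, hr]
    refine ⟨PowerSeries.C (a k) * PowerSeries.X ^ r * (-w *
      ((cFracTrunc a q (n + 1) (k + 1))⁻¹ * (cFracTrunc a q n (k + 1))⁻¹)), ?_⟩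
    ring

/-- Every C-fraction with positive exponents gives exactly one power series. -/
theorem existsUnique_isCFraction {K : Type*} [Field K] (a : ℕ → K) (q : ℕ → ℕ)
    (hq : ∀ i, 1 ≤ i → 1 ≤ q i) : ∃! g : K⟦X⟧, IsCFraction a q g := by
  have hstep : ∀ N n, N ≤ n → PowerSeries.coeff N (cFracApprox a q (n + 1)) =
      PowerSeries.coeff N (cFracApprox a q n) := by
    intro N n hN
    obtain ⟨w, hw⟩ := X_pow_dvd_cFracTrunc_sub a q n hq 1 le_rfl
    have h1 : PowerSeries.constantCoeff (cFracTrunc a q (n + 1) 1) ≠ 0 := by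
      rw [constantCoeff_cFracTrunc a q _ _ le_rfl hq]; exact one_ne_zero
    have h0 : PowerSeries.constantCoeff (cFracTrunc a q n 1) ≠ 0 := by
      rw [constantCoeff_cFracTrunc a q _ _ le_rfl hq]; exact one_ne_zero
    have e1 := PowerSeries.mul_inv_cancel _ h1
    have e0 := PowerSeries.mul_inv_cancel _ h0
    have key : cFracApprox a q (n + 1) - cFracApprox a q n =
        PowerSeries.X ^ (n + 1) * (-w *
          ((cFracTrunc a q (n + 1) 1)⁻¹ * (cFracTrunc a q n 1)⁻¹)) := by
      unfold cFracApprox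
      linear_combination (cFracTrunc a q n 1)⁻¹ * e1 - (cFracTrunc a q (n + 1) 1)⁻¹ * e0
        - (cFracTrunc a q (n + 1) 1)⁻¹ * (cFracTrunc a q n 1)⁻¹ * hw
    rw [← sub_eq_zero, ← map_sub, key, PowerSeries.coeff_X_pow_mul']
    simp [show ¬ (n + 1 ≤ N) by omega]
  refine ⟨PowerSeries.mk fun N => PowerSeries.coeff N (cFracApprox a q N), ?_, ?_⟩
  · intro N
    filter_upwards [eventually_ge_atTop N] with n hn
    rw [PowerSeries.coeff_mk]
    induction n, hn using Nat.le_induction with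
    | base => rfl
    | succ n hn ih => rw [hstep N n hn, ih]
  · intro g hg
    ext N
    obtain ⟨n, h1, h2⟩ := ((hg N).and (eventually_ge_atTop N)).exists
    rw [← h1, PowerSeries.coeff_mk]
    clear h1
    induction n, h2 using Nat.le_induction with
    | base => rfl
    | succ n hn ih => rw [hstep N n hn, ih]

/-- The Hankel determinant of order `n` of the sequence `c`, i.e. the determinant of the `n × n`
matrix `(c (i + j))` with `0 ≤ i, j < n`. -/
def hankelDet {K : Type*} [Field K] (c : ℕ → K) (n : ℕ) : K :=
  Matrix.det (Matrix.of fun i j : Fin n => c ((i : ℕ) + (j : ℕ)))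

/-- The sequence `1, q₁, q₂, q₃, …`. -/
def qTilde (q : ℕ → ℕ) (n : ℕ) : ℕ := if n = 0 then 1 else q n

/-- `p_i = ∑_{j=0}^{i} (-1)^(i-j) q̃_j`, an integer. -/
def pSeq (q : ℕ → ℕ) (i : ℕ) : ℤ :=
  ∑ j ∈ Finset.range (i + 1), (-1 : ℤ) ^ (i - j) * (qTilde q j : ℤ)

end

/-!
Write `F_k` for the tail `1 / (1 + a_k X ^ q_k F_{k+1})` of the continued fraction, so that `c` is
the coefficient sequence of `F_1`, and let `D p F n` be the determinant of order `n` of the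
coefficients of `F` of index `i + j + 1 - p`, those of negative index being zero. The `n`-th Hankel
determinant is `D p_0 F_1 n`, as `p_0 = 1`. Everything follows from two facts about `D`.

* If `0 < n < p`, then `D p F n = 0`, because the first row vanishes.
* If `F * G = 1` and `n = p + r`, then multiplying by the unitriangular Toeplitz matrix of `G` makes
  the matrix block triangular, and `D p F n` is, up to the sign `(-1) ^ (p (p - 1) / 2 + r)`, the
  determinant of order `r` of the coefficients of `G` of index `i + j + p + 1`
  (`shiftedHankelDet_X_pow_mul`). For `G = 1 + a X ^ (p + p') F'` only the second summand
  contributes, which gives `(-1) ^ (p (p - 1) / 2) (-a) ^ r D p' F' r`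
  (`shiftedHankelDet_continuedFraction_step`).

Since `p_{k-1} + p_k = q_k`, the second fact can be iterated: `m` steps turn `D p_0 F_1 n` into an
explicit multiple of `D p_m F_{m+1} (n - p_0 - ⋯ - p_{m-1})` (`shiftedHankelDet_cFracTrunc`). If `n`
is a partial sum of the `p_k`, this ends with an empty determinant; if `n` lies strictly between two
consecutive partial sums, it ends with the first fact. As `D p F n` involves only finitely many
coefficients, the fraction may be replaced by a long enough truncation.
-/

/-! ### Hankel determinants and reciprocal power series -/

open Finset in
/-- The part of the convolution of `f` and `g` in which the index of `f` exceeds `i`. -/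
theorem PowerSeries.sum_range_coeff_mul_coeff {R : Type*} [CommRing R] (f g : R⟦X⟧) (i k : ℕ) :
    ∑ j ∈ range (k + 1), PowerSeries.coeff (i + j + 1) f * PowerSeries.coeff (k - j) g =
      PowerSeries.coeff (i + k + 1) (f * g) -
        ∑ l ∈ range (i + 1), PowerSeries.coeff l f * PowerSeries.coeff (i + k + 1 - l) g := by
  rw [PowerSeries.coeff_mul, Nat.sum_antidiagonal_eq_sum_range_succ_mk,
    show (i + k + 1).succ = (i + 1) + (k + 1) by omega, Finset.sum_range_add _ (i + 1) (k + 1),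
    add_sub_cancel_left]
  refine sum_congr rfl fun j _ => ?_
  rw [show i + 1 + j = i + j + 1 by omega, show i + k + 1 - (i + j + 1) = k - j by omega]

theorem det_antidiagonal_one (R : Type*) [CommRing R] (p : ℕ) :
    Matrix.det (Matrix.of fun i j : Fin p => if (i : ℕ) + j + 1 = p then (1 : R) else 0) =
      (-1) ^ p.choose 2 := by
  induction p with
  | zero => simp
  | succ p ih =>
    rw [Matrix.det_succ_row_zero, Finset.sum_eq_single (Fin.last p)]
    · have h : (Matrix.of fun i j : Fin (p + 1) =>
          if (i : ℕ) + j + 1 = p + 1 then (1 : R) else 0).submatrix Fin.succ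
            (Fin.last p).succAbove =
          Matrix.of fun i j : Fin p => if (i : ℕ) + j + 1 = p then (1 : R) else 0 := by
        ext i j
        simp only [Matrix.submatrix_apply, Matrix.of_apply, Fin.succAbove_last, Fin.val_succ,
          Fin.val_castSucc]
        congr 1
        simp only [eq_iff_iff]
        omega
      rw [h, ih, Nat.choose_succ_succ' p 1, Nat.choose_one_right, pow_add]
      simp
    · intro j _ hj
      have : (j : ℕ) ≠ p := fun h => hj (Fin.ext h)
      simp [this]
    · simp

/-- The Hankel determinant of order `n` of the coefficients of `f` from degree one on. For
`f = X ^ p * F` this is the determinant of the coefficients of `F` of index `i + j + 1 - p`, those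
of negative index being zero. -/
noncomputable def shiftedHankelDet {R : Type*} [CommRing R] (f : R⟦X⟧) (n : ℕ) : R :=
  Matrix.det (Matrix.of fun i j : Fin n => PowerSeries.coeff ((i : ℕ) + j + 1) f)

theorem shiftedHankelDet_eq_zero_of_lt {R : Type*} [CommRing R] (F : R⟦X⟧) {p n : ℕ}
    (hn : 0 < n) (hnp : n < p) : shiftedHankelDet (PowerSeries.X ^ p * F) n = 0 := by
  refine Matrix.det_eq_zero_of_row_eq_zero ⟨0, hn⟩ fun j => ?_
  rw [Matrix.of_apply, PowerSeries.coeff_X_pow_mul', if_neg]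
  have := j.2
  simp only
  omega

/-- Multiplying on the right by the unitriangular Toeplitz matrix of `G = F⁻¹` turns the Hankel
matrix of `X ^ p * F` into a block lower triangular one. Its diagonal blocks are the antidiagonal
identity of size `p` and minus the product of the unitriangular Toeplitz matrix of `F` with a
Hankel matrix of `G`. -/
theorem shiftedHankelDet_X_pow_mul {R : Type*} [CommRing R] {F G : R⟦X⟧} (h : F * G = 1)
    (hF : PowerSeries.constantCoeff F = 1) (hG : PowerSeries.constantCoeff G = 1) (p r : ℕ) :
    shiftedHankelDet (PowerSeries.X ^ p * F) (p + r) =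
      (-1) ^ (p.choose 2 + r) *
        Matrix.det (Matrix.of fun i j : Fin r => PowerSeries.coeff ((i : ℕ) + j + p + 1) G) := by
  set A : Matrix (Fin (p + r)) (Fin (p + r)) R :=
    Matrix.of fun i j => PowerSeries.coeff ((i : ℕ) + j + 1) (PowerSeries.X ^ p * F) with hA
  set U : Matrix (Fin (p + r)) (Fin (p + r)) R :=
    Matrix.of fun j k => if j ≤ k then PowerSeries.coeff ((k : ℕ) - j) G else 0 with hU
  set L : Matrix (Fin r) (Fin r) R :=
    Matrix.of fun i l => if l ≤ i then PowerSeries.coeff ((i : ℕ) - l) F else 0 with hL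
  set M : Matrix (Fin r) (Fin r) R :=
    Matrix.of fun i j => PowerSeries.coeff ((i : ℕ) + j + p + 1) G with hM
  have hdetU : U.det = 1 := by
    rw [Matrix.det_of_isUpperTriangular]
    · refine Finset.prod_eq_one fun i _ => ?_
      simpa [hU] using hG
    · intro i j hij
      simp only [id_eq] at hij
      simp [hU, hij]
  have hdetL : L.det = 1 := by
    rw [Matrix.det_of_isLowerTriangular]
    · refine Finset.prod_eq_one fun i _ => ?_
      simpa [hL] using hF
    · intro i j hij
      have hij : i < j := hij
      simp [hL, hij]
  have hprod : (PowerSeries.X : R⟦X⟧) ^ p * F * G = PowerSeries.X ^ p := by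
    rw [mul_assoc, h, mul_one]
  -- The entries of `A * U` are full convolutions `X ^ p * F * G = X ^ p` up to a correction term.
  have hentry : ∀ i k : Fin (p + r), (A * U) i k =
      (if (i : ℕ) + k + 1 = p then 1 else 0) -
        ∑ l ∈ Finset.range ((i : ℕ) + 1), PowerSeries.coeff l (PowerSeries.X ^ p * F) *
          PowerSeries.coeff ((i : ℕ) + k + 1 - l) G := by
    intro i k
    have hX := PowerSeries.coeff_X_pow (R := R) ((i : ℕ) + k + 1) p
    rw [← hprod] at hX
    rw [← hX, ← PowerSeries.sum_range_coeff_mul_coeff, Matrix.mul_apply]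
    simp only [hA, hU, Matrix.of_apply, mul_ite, mul_zero, Fin.le_def]
    rw [Fin.sum_univ_eq_sum_range (fun j => if j ≤ (k : ℕ) then
      PowerSeries.coeff ((i : ℕ) + j + 1) (PowerSeries.X ^ p * F) *
        PowerSeries.coeff ((k : ℕ) - j) G else 0), ← Finset.sum_filter]
    congr 1
    ext j
    have := k.2
    simp only [Finset.mem_filter, Finset.mem_range]
    omega
  have hlow : ∀ i : Fin p, ∀ k : ℕ, ∑ l ∈ Finset.range ((i : ℕ) + 1),
      PowerSeries.coeff l (PowerSeries.X ^ p * F) * PowerSeries.coeff ((i : ℕ) + k + 1 - l) G =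
        0 := by
    intro i k
    refine Finset.sum_eq_zero fun l hl => ?_
    have := i.2
    rw [Finset.mem_range] at hl
    rw [PowerSeries.coeff_X_pow_mul', if_neg (by omega), zero_mul]
  have h12 : ((A * U).submatrix finSumFinEquiv finSumFinEquiv).toBlocks₁₂ = 0 := by
    ext i k
    have := i.2
    simp only [Matrix.toBlocks₁₂, Matrix.of_apply, Matrix.submatrix_apply, hentry,
      finSumFinEquiv_apply_left, finSumFinEquiv_apply_right, Fin.val_castAdd, Fin.val_natAdd,
      hlow, Matrix.zero_apply]
    rw [if_neg (by omega), sub_zero]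
  have h11 : ((A * U).submatrix finSumFinEquiv finSumFinEquiv).toBlocks₁₁ =
      Matrix.of fun i j : Fin p => if (i : ℕ) + j + 1 = p then (1 : R) else 0 := by
    ext i k
    simp only [Matrix.toBlocks₁₁, Matrix.of_apply, Matrix.submatrix_apply, hentry,
      finSumFinEquiv_apply_left, Fin.val_castAdd, hlow, sub_zero]
  have h22 : ((A * U).submatrix finSumFinEquiv finSumFinEquiv).toBlocks₂₂ = -(L * M) := by
    ext i k
    have hi := i.2
    simp only [Matrix.toBlocks₂₂, Matrix.of_apply, Matrix.submatrix_apply, hentry,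
      finSumFinEquiv_apply_right, Fin.val_natAdd, Matrix.neg_apply, Matrix.mul_apply, hL, hM,
      ite_mul, zero_mul, Fin.le_def]
    rw [if_neg (by omega), zero_sub, Fin.sum_univ_eq_sum_range (fun l => if l ≤ (i : ℕ) then
      PowerSeries.coeff ((i : ℕ) - l) F * PowerSeries.coeff (l + k + p + 1) G else 0),
      ← Finset.sum_filter, add_assoc p, Finset.sum_range_add, Finset.sum_eq_zero, zero_add,
      ← Finset.sum_range_reflect]
    · congr 1
      have hr : (Finset.range r).filter (· ≤ (i : ℕ)) = Finset.range ((i : ℕ) + 1) := by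
        ext j
        simp only [Finset.mem_filter, Finset.mem_range]
        omega
      rw [hr]
      refine Finset.sum_congr rfl fun l hl => ?_
      rw [Finset.mem_range] at hl
      rw [show p + ((i : ℕ) + 1 - 1 - l) = (i - l) + p by omega, PowerSeries.coeff_X_pow_mul,
        show p + (i : ℕ) + (p + k) + 1 - (i - l + p) = l + k + p + 1 by omega]
    · intro l hl
      rw [Finset.mem_range] at hl
      rw [PowerSeries.coeff_X_pow_mul', if_neg (by omega), zero_mul]
  calc shiftedHankelDet (PowerSeries.X ^ p * F) (p + r) = (A * U).det := by
        rw [Matrix.det_mul, hdetU, mul_one]; rfl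
    _ = _ := by
        rw [← Matrix.det_submatrix_equiv_self finSumFinEquiv,
          ← Matrix.fromBlocks_toBlocks ((A * U).submatrix finSumFinEquiv finSumFinEquiv), h12,
          Matrix.det_fromBlocks_zero₁₂, h11, h22, det_antidiagonal_one, Matrix.det_neg,
          Matrix.det_mul, hdetL, one_mul, Fintype.card_fin, pow_add, mul_assoc]

/-! ### Descent along the continued fraction -/

/-- One step down the continued fraction: removing the top partial quotient `b X ^ (p + p')` lowers
the order of the determinant by `p` and turns the shift `p` into `p'`. -/
theorem shiftedHankelDet_continuedFraction_step {R : Type*} [CommRing R] {F F' : R⟦X⟧} (b : R)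
    (p p' r : ℕ) (h : F * (1 + PowerSeries.C b * PowerSeries.X ^ (p + p') * F') = 1)
    (hpp : p + p' ≠ 0) :
    shiftedHankelDet (PowerSeries.X ^ p * F) (p + r) =
      (-1) ^ p.choose 2 * (-b) ^ r * shiftedHankelDet (PowerSeries.X ^ p' * F') r := by
  have hG : PowerSeries.constantCoeff (1 + PowerSeries.C b * PowerSeries.X ^ (p + p') * F') =
      1 := by
    simp [zero_pow hpp]
  have hF : PowerSeries.constantCoeff F = 1 := by
    have := congrArg PowerSeries.constantCoeff h
    rwa [map_mul, hG, mul_one, map_one] at this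
  have hM : (Matrix.of fun i j : Fin r => PowerSeries.coeff ((i : ℕ) + j + p + 1)
        (1 + PowerSeries.C b * PowerSeries.X ^ (p + p') * F')) =
      b • Matrix.of fun i j : Fin r =>
        PowerSeries.coeff ((i : ℕ) + j + 1) (PowerSeries.X ^ p' * F') := by
    ext i j
    rw [Matrix.smul_apply, Matrix.of_apply, Matrix.of_apply, map_add, PowerSeries.coeff_one,
      if_neg (by omega), zero_add, mul_assoc, PowerSeries.coeff_C_mul, pow_add, mul_assoc,
      show (i : ℕ) + j + p + 1 = (i + j + 1) + p by omega, PowerSeries.coeff_X_pow_mul,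
      smul_eq_mul]
  rw [shiftedHankelDet_X_pow_mul h hF hG, hM, Matrix.det_smul, Fintype.card_fin, neg_pow b,
    pow_add]
  simp only [shiftedHankelDet]
  ring

/-- The step down the continued fraction, iterated `m` times; `r` is the order that is left after
these steps. -/
theorem shiftedHankelDet_cFracTrunc {K : Type*} [Field K] (a : ℕ → K) (q : ℕ → ℕ)
    (hq : ∀ k, 1 ≤ k → 1 ≤ q k) (P : ℕ → ℕ) (hP : ∀ i, P i + P (i + 1) = q (i + 1))
    (N m r : ℕ) (hm : m ≤ N) :
    shiftedHankelDet (PowerSeries.X ^ P 0 * (cFracTrunc a q N 1)⁻¹)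
        (∑ i ∈ Finset.range m, P i + r) =
      (∏ i ∈ Finset.range m, (-1) ^ (P i).choose 2 *
          (-a (i + 1)) ^ (r + ∑ j ∈ Finset.Ico (i + 1) m, P j)) *
        shiftedHankelDet (PowerSeries.X ^ P m * (cFracTrunc a q (N - m) (m + 1))⁻¹) r := by
  induction m generalizing r with
  | zero => simp
  | succ m ih =>
    obtain ⟨N', hN'⟩ : ∃ N', N - m = N' + 1 := ⟨N - m - 1, by omega⟩
    have hc : (cFracTrunc a q (N' + 1) (m + 1))⁻¹ *
        (1 + PowerSeries.C (a (m + 1)) * PowerSeries.X ^ (P m + P (m + 1)) *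
          (cFracTrunc a q N' (m + 1 + 1))⁻¹) = 1 := by
      rw [hP]
      refine PowerSeries.inv_mul_cancel _ ?_
      rw [constantCoeff_cFracTrunc a q _ _ (by omega) hq]
      exact one_ne_zero
    have hne : P m + P (m + 1) ≠ 0 := by
      have := hq (m + 1) (by omega)
      rw [hP]
      omega
    rw [Finset.sum_range_succ, add_assoc, ih _ (by omega), hN',
      shiftedHankelDet_continuedFraction_step _ _ _ _ hc hne, Finset.prod_range_succ,
      show N - (m + 1) = N' by omega, Finset.Ico_self, Finset.sum_empty, add_zero, ← mul_assoc]
    congr 2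
    refine Finset.prod_congr rfl fun i hi => ?_
    rw [Finset.mem_range] at hi
    rw [Finset.sum_Ico_succ_top (by omega), add_right_comm, add_comm _ r, add_comm (P m)]

theorem hankelDet_eq_shiftedHankelDet_cFracTrunc {K : Type*} [Field K] {a : ℕ → K} {q : ℕ → ℕ}
    {c : ℕ → K} (hc : IsCFraction a q (PowerSeries.mk c)) (n M : ℕ) :
    ∃ N, M ≤ N ∧ hankelDet c n =
      shiftedHankelDet (PowerSeries.X ^ 1 * (cFracTrunc a q N 1)⁻¹) n := by
  have h : ∀ᶠ N in atTop, ∀ k ∈ Finset.range (2 * n),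
      PowerSeries.coeff k (cFracApprox a q N) = PowerSeries.coeff k (PowerSeries.mk c) :=
    (Filter.eventually_all_finset _).2 fun k _ => hc k
  obtain ⟨N, hN, hM⟩ := (h.and (eventually_ge_atTop M)).exists
  refine ⟨N, hM, ?_⟩
  unfold hankelDet shiftedHankelDet
  congr 1
  ext i j
  rw [Matrix.of_apply, Matrix.of_apply, PowerSeries.coeff_X_pow_mul]
  have := hN (i + j) (by rw [Finset.mem_range]; omega)
  rw [PowerSeries.coeff_mk] at this
  exact this.symm

/-! ### The sequence `p` and the sign -/

theorem pSeq_add_pSeq_succ (q : ℕ → ℕ) (i : ℕ) : pSeq q i + pSeq q (i + 1) = q (i + 1) := by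
  have h : pSeq q (i + 1) = -pSeq q i + q (i + 1) := by
    unfold pSeq
    rw [Finset.sum_range_succ, ← Finset.sum_neg_distrib]
    congr 1
    · refine Finset.sum_congr rfl fun j hj => ?_
      rw [Finset.mem_range] at hj
      rw [show i + 1 - j = (i - j) + 1 by omega, pow_succ]
      ring
    · simp [qTilde]
  rw [h]
  ring

/-- The sign produced by the descent agrees with the closed form. Both `P i * (P i + 1) / 2` and
`(P i).choose 2` occur, and their difference `P i` accounts for the weight `i` in place of `i + 1`
in the last exponent; the summand `1` there compensates for `P 0`. -/
theorem prod_neg_one_pow_choose_two_mul_tail_sums {R : Type*} [CommRing R] (P : ℕ → ℕ)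
    (h0 : P 0 = 1) (m : ℕ) :
    ∏ i ∈ Finset.range (m + 1),
        ((-1 : R) ^ (P i).choose 2 * (-1) ^ ∑ j ∈ Finset.Ico (i + 1) (m + 1), P j) =
      (∏ i ∈ Finset.range (m + 1), (-1 : R) ^ (P i * (P i + 1) / 2)) *
        (-1) ^ (1 + ∑ i ∈ Finset.range m, i * P (i + 1)) := by
  induction m with
  | zero => simp [h0]
  | succ m ih =>
    have htri : ∀ p : ℕ, p * (p + 1) / 2 = p + p.choose 2 := fun p => by
      have h := Nat.choose_two_right (p + 1)
      rw [Nat.choose_succ_succ' p 1, Nat.choose_one_right, Nat.add_sub_cancel, mul_comm] at h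
      exact h.symm
    rw [Finset.prod_range_succ, Finset.prod_range_succ _ (m + 1), Finset.sum_range_succ,
      Finset.Ico_self, Finset.sum_empty, pow_zero, mul_one, htri (P (m + 1)), ← add_assoc,
      pow_add _ (1 + _)]
    have hstep : ∏ i ∈ Finset.range (m + 1),
        ((-1 : R) ^ (P i).choose 2 * (-1) ^ ∑ j ∈ Finset.Ico (i + 1) (m + 1 + 1), P j) =
        (∏ i ∈ Finset.range (m + 1),
          ((-1 : R) ^ (P i).choose 2 * (-1) ^ ∑ j ∈ Finset.Ico (i + 1) (m + 1), P j)) *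
          (-1) ^ (P (m + 1) * (m + 1)) := by
      rw [pow_mul]
      have hconst := Finset.prod_const (s := Finset.range (m + 1)) ((-1 : R) ^ P (m + 1))
      rw [Finset.card_range] at hconst
      rw [← hconst, ← Finset.prod_mul_distrib]
      refine Finset.prod_congr rfl fun i hi => ?_
      rw [Finset.mem_range] at hi
      rw [Finset.sum_Ico_succ_top (by omega), pow_add, mul_assoc]
    rw [hstep, ih]
    ring

/-! ### Hankel determinants of C-fractions -/

theorem proposition3 {K : Type*} [Field K] (a : ℕ → K) (q : ℕ → ℕ)
    (hq : ∀ k, 1 ≤ k → 1 ≤ q k) (hp : ∀ i, 0 ≤ pSeq q i)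
    (c : ℕ → K) (hc : IsCFraction a q (PowerSeries.mk c)) :
    (∀ n : ℕ, 1 ≤ n → (¬ ∃ m : ℕ, (n : ℤ) = ∑ k ∈ Finset.range (m + 1), pSeq q k) →
      hankelDet c n = 0) ∧
    (∀ n m : ℕ, (n : ℤ) = ∑ k ∈ Finset.range (m + 1), pSeq q k →
      hankelDet c n =
        (∏ i ∈ Finset.range (m + 1), (-1 : K) ^ (pSeq q i * (pSeq q i + 1) / 2)) *
        (-1 : K) ^ (1 + ∑ i ∈ Finset.range m, (i : ℤ) * pSeq q (i + 1)) *
        ∏ k ∈ Finset.Icc 1 m, a k ^ (∑ i ∈ Finset.Icc k m, pSeq q i) ∧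
      ((∀ k, 1 ≤ k → k ≤ m → a k ≠ 0) → hankelDet c n ≠ 0)) := by
  obtain ⟨P, hpP⟩ : ∃ P : ℕ → ℕ, ∀ i, pSeq q i = (P i : ℤ) :=
    ⟨fun i => (pSeq q i).toNat, fun i => (Int.toNat_of_nonneg (hp i)).symm⟩
  have hP0 : P 0 = 1 := by
    have := hpP 0
    simp only [pSeq, qTilde, zero_add, Finset.range_one, Finset.sum_singleton] at this
    simpa using this.symm
  have hP : ∀ i, P i + P (i + 1) = q (i + 1) := fun i => by
    have := pSeq_add_pSeq_succ q i
    rw [hpP, hpP] at this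
    exact_mod_cast this
  constructor
  · intro n hn hex
    have hne : ∀ m, n ≠ ∑ k ∈ Finset.range (m + 1), P k := fun m hm =>
      hex ⟨m, by simp only [hpP]; exact_mod_cast hm⟩
    -- Two consecutive terms of `P` add up to a positive `q`, so the partial sums are unbounded.
    have hgrow : ∀ m, m ≤ ∑ k ∈ Finset.range (2 * m), P k := by
      intro m
      induction m with
      | zero => simp
      | succ m ih =>
        rw [show 2 * (m + 1) = 2 * m + 1 + 1 by ring, Finset.sum_range_succ,
          Finset.sum_range_succ]
        have h1 := hP (2 * m)
        have h2 := hq (2 * m + 1) (by omega)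
        omega
    -- `n` lies strictly between two consecutive partial sums of `P`.
    obtain ⟨m, hm, hm'⟩ : ∃ m, ∑ k ∈ Finset.range m, P k < n ∧
        n < ∑ k ∈ Finset.range (m + 1), P k := by
      classical
      have hlt : ∃ m, n < ∑ k ∈ Finset.range (m + 1), P k :=
        ⟨2 * n + 1, by have := hgrow (n + 1); rw [mul_add] at this; exact this⟩
      refine ⟨Nat.find hlt, ?_, Nat.find_spec hlt⟩
      rcases hj : Nat.find hlt with _ | j
      · simpa using Nat.pos_of_ne_zero (by omega)
      · have := Nat.find_min hlt (m := j) (by omega)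
        have := hne j
        omega
    obtain ⟨N, hN, hdet⟩ := hankelDet_eq_shiftedHankelDet_cFracTrunc hc n m
    obtain ⟨r, rfl⟩ := Nat.exists_eq_add_of_lt hm
    rw [Finset.sum_range_succ] at hm'
    have hstep := shiftedHankelDet_cFracTrunc a q hq P hP N m (r + 1) hN
    rw [hP0, ← add_assoc, shiftedHankelDet_eq_zero_of_lt _ (n := r + 1) (by omega) (by omega),
      mul_zero] at hstep
    rw [hdet, hstep]
  · intro n m hnm
    have hn : n = ∑ k ∈ Finset.range (m + 1), P k := by
      simp only [hpP] at hnm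
      exact_mod_cast hnm
    have hdet : hankelDet c n =
        (∏ i ∈ Finset.range (m + 1), (-1 : K) ^ (P i * (P i + 1) / 2)) *
        (-1) ^ (1 + ∑ i ∈ Finset.range m, i * P (i + 1)) *
        ∏ k ∈ Finset.Icc 1 m, a k ^ (∑ i ∈ Finset.Icc k m, P i) := by
      -- After `m + 1` steps the order left is zero.
      obtain ⟨N, hN, hdet⟩ := hankelDet_eq_shiftedHankelDet_cFracTrunc hc n (m + 1)
      have := shiftedHankelDet_cFracTrunc a q hq P hP N (m + 1) 0 hN
      rw [add_zero, hP0, ← hn, ← hdet] at this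
      rw [this, ← prod_neg_one_pow_choose_two_mul_tail_sums P hP0]
      have hone : ∀ f : K⟦X⟧, shiftedHankelDet f 0 = 1 := fun f => Matrix.det_isEmpty
      have hprod : ∏ k ∈ Finset.Icc 1 m, a k ^ (∑ i ∈ Finset.Icc k m, P i) =
          ∏ i ∈ Finset.range (m + 1), a (i + 1) ^ (∑ j ∈ Finset.Ico (i + 1) (m + 1), P j) := by
        rw [Finset.prod_range_succ, Finset.Ico_self, Finset.sum_empty, pow_zero, mul_one,
          Finset.range_eq_Ico,
          Finset.prod_Ico_add' (fun k => a k ^ (∑ j ∈ Finset.Ico k (m + 1), P j))]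
        rfl
      rw [hone, mul_one, hprod, ← Finset.prod_mul_distrib]
      refine Finset.prod_congr rfl fun i _ => ?_
      rw [zero_add, neg_pow (a (i + 1)), mul_assoc]
    refine ⟨?_, fun ha => ?_⟩
    · simp only [hpP]
      rw [hdet]
      norm_cast
    · rw [hdet]
      refine mul_ne_zero (mul_ne_zero ?_ ?_) ?_
      · exact Finset.prod_ne_zero_iff.2 fun i _ => pow_ne_zero _ (neg_ne_zero.2 one_ne_zero)
      · exact pow_ne_zero _ (neg_ne_zero.2 one_ne_zero)
      · refine Finset.prod_ne_zero_iff.2 fun k hk => pow_ne_zero _ ?_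
        rw [Finset.mem_Icc] at hk
        exact ha k hk.1 hk.2
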